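/- All graphs are finite and simple. A drawing of a graph in the plane maps the vertices to distinct points and each edge to a Jordan arc between the images of its endpoints that avoids the image of every other vertex; it is plane if no two edges intersect except at a common endpoint, and a graph is planar if it has a plane drawing. A biarc diagram is a drawing in which all vertices lie on a horizontal line (the spine) and every edge is drawn either as a proper arc, that is, one halfcircle centered on the spine, or as a biarc, that is, the union of two (nondegenerate) halfcircles centered on the spine that share an endpoint, one above and one below the spine. Subdividing an edge $e$ means replacing $e$ by a new vertex that is connected to both endpoints of $e$. A graph is Hamiltonian if it contains a cycle through all its vertices, and subhamiltonian if it can be augmented to a Hamiltonian planar graph by adding edges (possibly none) between its vertices. Theorem. Let $G$ be a planar graph with at least three vertices and let $k \ge 0$ be an integer. Then $G$ admits a plane biarc diagram with at most $k$ biarcs if and only if there is a set of at most $k$ edges of $G$ such that subdividing these edges transforms $G$ into a subhamiltonian graph. -/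

import Mathlib

/-- `S` is a Jordan arc in the plane between the points `p` and `q`: the image of an injective
continuous path from `p` to `q`. -/
def IsJordanArc (S : Set (ℝ × ℝ)) (p q : ℝ × ℝ) : Prop :=
  ∃ γ : Path p q, Function.Injective γ ∧ Set.range γ = S

/-- The closed halfcircle above the `x`-axis, centered on the `x`-axis, with endpoints
`(a, 0)` and `(b, 0)`. -/
def upperHalfCircle (a b : ℝ) : Set (ℝ × ℝ) :=
  {p | (p.1 - (a + b) / 2) ^ 2 + p.2 ^ 2 = ((b - a) / 2) ^ 2 ∧ 0 ≤ p.2}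

/-- The closed halfcircle below the `x`-axis, centered on the `x`-axis, with endpoints
`(a, 0)` and `(b, 0)`. -/
def lowerHalfCircle (a b : ℝ) : Set (ℝ × ℝ) :=
  {p | (p.1 - (a + b) / 2) ^ 2 + p.2 ^ 2 = ((b - a) / 2) ^ 2 ∧ p.2 ≤ 0}

/-- `S` is a proper arc between the points `(a, 0)` and `(b, 0)` of the spine: one halfcircle,
above or below the spine. -/
def IsProperArc (S : Set (ℝ × ℝ)) (a b : ℝ) : Prop :=
  S = upperHalfCircle a b ∨ S = lowerHalfCircle a b

/-- `S` is a biarc between the points `(a, 0)` and `(b, 0)` of the spine: the union of two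
(nondegenerate) halfcircles, one above and one below the spine, that meet at a point `(m, 0)` of
the spine. Both halfcircles are vertical at `(m, 0)` and lie on different sides of the spine, so
that their union is smooth there; `m` need not lie between `a` and `b`. -/
def IsBiarc (S : Set (ℝ × ℝ)) (a b : ℝ) : Prop :=
  ∃ m : ℝ, m ≠ a ∧ m ≠ b ∧
    (S = upperHalfCircle a m ∪ lowerHalfCircle m b ∨
      S = lowerHalfCircle a m ∪ upperHalfCircle m b)

namespace SimpleGraph

universe u

/-- A drawing of `G` in the plane: the vertices are mapped to distinct points and each edge to a
Jordan arc between the images of its two endpoints that is disjoint from the image of any other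
vertex. (The values of `arc` outside the edge set of `G` are irrelevant.) -/
structure Drawing {V : Type u} (G : SimpleGraph V) where
  /-- the points that represent the vertices -/
  point : V → ℝ × ℝ
  /-- the arcs that represent the edges -/
  arc : Sym2 V → Set (ℝ × ℝ)
  point_injective : Function.Injective point
  isJordanArc : ∀ u v, G.Adj u v → IsJordanArc (arc s(u, v)) (point u) (point v)
  mem_of_point_mem_arc : ∀ e ∈ G.edgeSet, ∀ w : V, point w ∈ arc e → w ∈ e

namespace Drawing

variable {V : Type u} {G : SimpleGraph V}

/-- A drawing is plane if no two edges intersect except at a common endpoint. -/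
def IsPlane (D : G.Drawing) : Prop :=
  ∀ e ∈ G.edgeSet, ∀ f ∈ G.edgeSet, e ≠ f →
    ∀ p ∈ D.arc e ∩ D.arc f, ∃ v : V, v ∈ e ∧ v ∈ f ∧ p = D.point v

/-- A biarc diagram: the vertices are points of the spine (the `x`-axis), and every edge is drawn
as a proper arc or as a biarc. -/
def IsBiarcDiagram (D : G.Drawing) : Prop :=
  (∀ v, (D.point v).2 = 0) ∧
    ∀ u v, G.Adj u v →
      IsProperArc (D.arc s(u, v)) (D.point u).1 (D.point v).1 ∨
        IsBiarc (D.arc s(u, v)) (D.point u).1 (D.point v).1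

/-- The set of edges that are drawn as biarcs. -/
def biarcs (D : G.Drawing) : Set (Sym2 V) :=
  {e | ∃ u v, G.Adj u v ∧ e = s(u, v) ∧ IsBiarc (D.arc e) (D.point u).1 (D.point v).1}

end Drawing

/-- A graph is planar if it has a plane drawing. -/
def IsPlanar {V : Type u} (G : SimpleGraph V) : Prop :=
  ∃ D : G.Drawing, D.IsPlane

/-- A finite graph is subhamiltonian if it can be augmented to a Hamiltonian planar graph on the
same vertices by adding edges. -/
def IsSubhamiltonian {V : Type u} [Fintype V] [DecidableEq V] (G : SimpleGraph V) : Prop :=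
  ∃ H : SimpleGraph V, G ≤ H ∧ H.IsPlanar ∧ H.IsHamiltonian

/-- The graph obtained from `G` by subdividing the edges in `F` (a set of edges of `G`): every
edge `e ∈ F` is replaced by a new vertex that is connected to both endpoints of `e`. -/
def subdivide {V : Type u} (G : SimpleGraph V) (F : Finset (Sym2 V)) : SimpleGraph (V ⊕ F) where
  Adj
    | Sum.inl u, Sum.inl v => G.Adj u v ∧ s(u, v) ∉ F
    | Sum.inl u, Sum.inr e => u ∈ e.1
    | Sum.inr e, Sum.inl u => u ∈ e.1
    | Sum.inr _, Sum.inr _ => False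
  symm := ⟨by
    rintro (u | e) (v | f) h
    · exact ⟨h.1.symm, by rw [Sym2.eq_swap]; exact h.2⟩
    · exact h
    · exact h
    · exact h⟩
  loopless := ⟨by
    rintro (u | e) h
    · exact G.loopless.irrefl u h.1
    · exact h⟩

end SimpleGraph

/-! Both conditions amount to a two-page book embedding of a subdivision of the graph (`IsTwoPage`).
A biarc diagram yields one: place a subdivision vertex where a biarc switches sides and colour each
halfcircle by its side, since halfcircles on one side with alternating endpoints would cross off the
spine. Edges between consecutive vertices, and between the two extreme ones, alternate with nothing,
so a book embedding extends to a planar Hamiltonian graph (`IsTwoPage.isSubhamiltonian`).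

Conversely, order the vertices of a planar Hamiltonian supergraph of the subdivision along the
cycle, and colour every other edge by the parity of the winding number of the cycle around it. Edges
with alternating endpoints have winding numbers of odd sum (`HasChordWinding.odd_add`). This stands
in for the Jordan curve theorem and is proved by comparing continuous logarithms; the half turn made
when the ends of a chord vector are exchanged produces the odd number. A subdivision vertex whose
two edges have the same colour is suppressed (`IsTwoPage.contract`). At every other one the two
halfcircles lie on opposite sides and form a biarc, so there are at most as many biarcs as
subdivided edges. -/

/-! ### Winding numbers around chords of a closed curve -/

section Winding

open Complex Set Topology

/-- A nonvanishing continuous function on a star convex set has a continuous logarithm. -/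
theorem StarConvex.exists_continuousOn_log {E : Type*} [NormedAddCommGroup E] [NormedSpace ℝ E]
    {S : Set E} {a : E} (hS : StarConvex ℝ a S) (ha : a ∈ S) {f : E → ℂ} (hf : ContinuousOn f S)
    (h0 : ∀ z ∈ S, f z ≠ 0) : ∃ g : E → ℂ, ContinuousOn g S ∧ ∀ z ∈ S, exp (g z) = f z := by
  classical
  have hmem : ∀ (t : unitInterval) (z : S), a + (t : ℝ) • ((z : E) - a) ∈ S := fun t z =>
    hS.add_smul_sub_mem z.2 t.2.1 t.2.2
  -- The homotopy from the constant `f a` to `f` along segments from `a`. It lifts through the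
  -- covering map `exp`, and the lift at time 1 is the logarithm.
  let H : C(unitInterval × S, {z : ℂ // z ≠ 0}) :=
    ⟨fun p => ⟨f (a + (p.1 : ℝ) • ((p.2 : E) - a)), h0 _ (hmem p.1 p.2)⟩, by
      refine Continuous.subtype_mk (hf.comp_continuous (f := fun p : unitInterval × S =>
        a + (p.1 : ℝ) • ((p.2 : E) - a)) (by fun_prop) fun p => hmem p.1 p.2) _⟩
  let F : C(S, ℂ) := ContinuousMap.const _ (log (f a))
  have H0 : ∀ z : S, H (0, z) = ⟨exp (F z), exp_ne_zero _⟩ := by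
    intro z
    apply Subtype.ext
    simp [H, F, exp_log (h0 a ha)]
  let G := isCoveringMap_exp.liftHomotopy H F H0
  have hG : ∀ z : S, exp (G (1, z)) = f z := by
    intro z
    have h : exp (G (1, z)) = (H (1, z)).1 :=
      congrArg Subtype.val (congrFun (isCoveringMap_exp.liftHomotopy_lifts H F H0) (1, z))
    rw [h]
    simp [H]
  refine ⟨fun z => if hz : z ∈ S then G (1, ⟨z, hz⟩) else 0, ?_, ?_⟩
  · rw [continuousOn_iff_continuous_domRestrict]
    have : Continuous fun z : S => G (1, z) := by fun_prop
    convert this using 1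
    ext z
    simp
  · intro z hz
    simpa [hz] using hG ⟨z, hz⟩

/-- Two continuous functions on a preconnected set whose exponentials differ by a constant factor
differ by a constant. -/
theorem IsPreconnected.eq_add_int_mul_of_exp_eq {X : Type*} [TopologicalSpace X] {S : Set X}
    (hS : IsPreconnected S) {f g : X → ℂ} (hf : ContinuousOn f S) (hg : ContinuousOn g S) (c : ℂ)
    (h : ∀ z ∈ S, exp (f z) = exp (g z + c)) :
    ∃ k : ℤ, ∀ z ∈ S, f z = g z + c + k * (2 * Real.pi * I) := by
  have key : ∀ z ∈ S, ∃ k : ℤ, f z = g z + c + k * (2 * Real.pi * I) := fun z hz =>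
    exp_eq_exp_iff_exists_int.1 (h z hz)
  have him : ∀ z (k : ℤ), f z = g z + c + k * (2 * Real.pi * I) →
      (f z - g z - c).im / (2 * Real.pi) = k := by
    intro z k hk
    rw [hk]
    simp
    field_simp
    ring
  rcases S.eq_empty_or_nonempty with rfl | ⟨z₀, hz₀⟩
  · exact ⟨0, by simp⟩
  obtain ⟨k, hk⟩ := key z₀ hz₀
  refine ⟨k, fun z hz => ?_⟩
  obtain ⟨l, hl⟩ := key z hz
  have := hS.constant_of_mapsTo (Int.isClosedEmbedding_coe_real.isInducing.isDiscrete_range)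
    (f := fun z => (f z - g z - c).im / (2 * Real.pi))
    ((continuous_im.comp_continuousOn ((hf.sub hg).sub continuousOn_const)).div_const _)
    (fun z hz => by
      obtain ⟨l, hl⟩ := key z hz
      exact ⟨l, (him z l hl).symm⟩) hz hz₀
  simp only [him z l hl, him z₀ k hk] at this
  rw [hl, Int.cast_injective this]

/-- The parameters of pairs of distinct points on a curve and on a chord of it. -/
def chordStrip (γ c : ℝ → ℂ) : Set (ℝ × ℝ) := {z | z.2 ∈ Icc (0 : ℝ) 1 ∧ γ z.1 ≠ c z.2}

/-- The closed curve `γ` of period `P` winds `w` times around the points of the chord `c`. -/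
def HasChordWinding (γ : ℝ → ℂ) (P : ℝ) (c : ℝ → ℂ) (w : ℤ) : Prop :=
  ∃ M : ℝ × ℝ → ℂ, ContinuousOn M (chordStrip γ c) ∧
    (∀ z ∈ chordStrip γ c, exp (M z) = γ z.1 - c z.2) ∧
    ∀ z ∈ chordStrip γ c, M (z.1 + P, z.2) = M z + w * (2 * Real.pi * I)

/-- Zeros of `γ t - c x` occur only at `x = 0` or `x = 1`. The strip without them is star convex
about `(0, 1/2)`, so a logarithm exists there and its change over a period is constant. -/
theorem exists_hasChordWinding {γ : ℝ → ℂ} {P : ℝ} (hγ : Continuous γ)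
    (hper : ∀ t, γ (t + P) = γ t) {c : ℝ → ℂ} (hc : ContinuousOn c (Icc 0 1))
    (hγc : ∀ t, ∀ x ∈ Ioo (0 : ℝ) 1, γ t ≠ c x) : ∃ w, HasChordWinding γ P c w := by
  have hmem : ((0 : ℝ), (1 / 2 : ℝ)) ∈ chordStrip γ c :=
    ⟨by norm_num, hγc _ _ (by norm_num)⟩
  have hstar : StarConvex ℝ ((0 : ℝ), (1 / 2 : ℝ)) (chordStrip γ c) := by
    rintro ⟨t, x⟩ ⟨hx, hne⟩ r s hr hs hrs
    simp only at hx hne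
    rcases hr.eq_or_lt with rfl | hr
    · obtain rfl : s = 1 := by linarith
      simpa using! And.intro hx hne
    · have hx' : r * (1 / 2) + s * x ∈ Ioo (0 : ℝ) 1 := by
        have h1 := mul_nonneg hs hx.1
        have h2 := mul_le_mul_of_nonneg_left hx.2 hs
        exact ⟨by linarith, by linarith⟩
      exact ⟨⟨by simpa using hx'.1.le, by simpa using hx'.2.le⟩, hγc _ _ (by simpa using hx')⟩
  have hcont : ContinuousOn (fun z : ℝ × ℝ => γ z.1 - c z.2) (chordStrip γ c) :=
    (hγ.comp continuous_fst).continuousOn.sub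
      (hc.comp continuous_snd.continuousOn fun z hz => hz.1)
  obtain ⟨M, hM, hexp⟩ := hstar.exists_continuousOn_log hmem hcont
    fun z hz => sub_ne_zero.2 hz.2
  have hshift : ∀ z ∈ chordStrip γ c, (z.1 + P, z.2) ∈ chordStrip γ c := fun z hz =>
    ⟨hz.1, by simpa [hper] using hz.2⟩
  obtain ⟨w, hw⟩ := (hstar.isPathConnected hmem).isConnected.isPreconnected.eq_add_int_mul_of_exp_eq
    (f := fun z => M (z.1 + P, z.2)) (hM.comp (by fun_prop) hshift) hM 0 (by
      intro z hz
      rw [add_zero, hexp z hz, hexp _ (hshift z hz), hper])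
  exact ⟨w, M, hM, hexp, fun z hz => by simpa using hw z hz⟩

/-- Two disjoint chords of a simple closed curve whose endpoints alternate along the curve lie on
different sides of it. -/
theorem HasChordWinding.odd_add {γ : ℝ → ℂ} {P : ℝ} (hγ : Continuous γ)
    (hper : ∀ t, γ (t + P) = γ t) (hinj : ∀ s t, s < t → t < s + P → γ s ≠ γ t)
    {a a' b b' : ℝ} (h1 : a < a') (h2 : a' < b) (h3 : b < b') (h4 : b' < a + P)
    {c d : ℝ → ℂ} (hc : ContinuousOn c (Icc 0 1)) (hd : ContinuousOn d (Icc 0 1))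
    (hc0 : c 0 = γ a) (hc1 : c 1 = γ b) (hd0 : d 0 = γ a') (hd1 : d 1 = γ b')
    (hcd : ∀ x ∈ Icc (0 : ℝ) 1, ∀ y ∈ Icc (0 : ℝ) 1, c x ≠ d y) {v w : ℤ}
    (hv : HasChordWinding γ P c v) (hw : HasChordWinding γ P d w) : Odd (v + w) := by
  obtain ⟨Mc, hMc, hMc', hv⟩ := hv
  obtain ⟨Md, hMd, hMd', hw⟩ := hw
  have hconv : Convex ℝ {z : ℝ × ℝ | z.1 < z.2 ∧ z.2 < z.1 + P} := by
    have e : {z : ℝ × ℝ | z.1 < z.2 ∧ z.2 < z.1 + P} =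
        {z : ℝ × ℝ | 0 < z.2 - z.1} ∩ {z : ℝ × ℝ | z.2 - z.1 < P} := by
      ext z
      simp [sub_lt_iff_lt_add']
    rw [e]
    exact (convex_halfSpace_gt (f := fun z : ℝ × ℝ => z.2 - z.1)
        (LinearMap.snd ℝ ℝ ℝ - LinearMap.fst ℝ ℝ ℝ).isLinear _).inter
      (convex_halfSpace_lt (f := fun z : ℝ × ℝ => z.2 - z.1)
        (LinearMap.snd ℝ ℝ ℝ - LinearMap.fst ℝ ℝ ℝ).isLinear _)
  -- a logarithm of the chord vectors of the curve
  obtain ⟨L, hL, hL'⟩ : ∃ L : ℝ × ℝ → ℂ, ContinuousOn L {z | z.1 < z.2 ∧ z.2 < z.1 + P} ∧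
      ∀ z ∈ {z : ℝ × ℝ | z.1 < z.2 ∧ z.2 < z.1 + P}, exp (L z) = γ z.2 - γ z.1 := by
    have hmem : (a, b) ∈ {z : ℝ × ℝ | z.1 < z.2 ∧ z.2 < z.1 + P} := by
      constructor <;> simp only <;> linarith
    exact (hconv.starConvex hmem).exists_continuousOn_log hmem (by fun_prop)
      fun z hz => sub_ne_zero.2 (hinj _ _ hz.1 hz.2).symm
  -- Exchanging the ends negates the chord vector, hence an odd multiple of `π * I`.
  obtain ⟨m, hm⟩ : ∃ m : ℤ, ∀ s t, s < t → t < s + P →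
      L (t, s + P) = L (s, t) + Real.pi * I + m * (2 * Real.pi * I) := by
    have hmaps : ∀ z ∈ {z : ℝ × ℝ | z.1 < z.2 ∧ z.2 < z.1 + P},
        (z.2, z.1 + P) ∈ {z : ℝ × ℝ | z.1 < z.2 ∧ z.2 < z.1 + P} := fun z hz =>
      ⟨hz.2, by simpa using hz.1⟩
    obtain ⟨m, hm⟩ := hconv.isPreconnected.eq_add_int_mul_of_exp_eq (f := fun z => L (z.2, z.1 + P))
      (hL.comp (by fun_prop) hmaps) hL (Real.pi * I) (by
        intro z hz
        rw [exp_add, exp_pi_mul_I, hL' z hz, hL' _ (hmaps z hz), hper]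
        ring)
    exact ⟨m, fun s t h h' => hm (s, t) ⟨h, h'⟩⟩
  -- a logarithm of the difference of the two chords
  obtain ⟨N, hN, hN'⟩ : ∃ N : ℝ × ℝ → ℂ, ContinuousOn N (Icc 0 1 ×ˢ Icc 0 1) ∧
      ∀ z ∈ Icc (0 : ℝ) 1 ×ˢ Icc (0 : ℝ) 1, exp (N z) = c z.1 - d z.2 := by
    have hmem : ((0 : ℝ), (0 : ℝ)) ∈ Icc (0 : ℝ) 1 ×ˢ Icc (0 : ℝ) 1 := by simp
    exact ((((convex_Icc 0 1).prod (convex_Icc 0 1)).starConvex hmem).exists_continuousOn_log hmem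
      ((hc.comp continuousOn_fst fun z hz => hz.1).sub (hd.comp continuousOn_snd fun z hz => hz.2))
      fun z hz => sub_ne_zero.2 (hcd _ hz.1 _ hz.2))
  -- comparison of a chord with the curve near an endpoint
  have hend : ∀ {e : ℝ → ℂ} {M : ℝ × ℝ → ℂ} (_ : ContinuousOn M (chordStrip γ e))
      (_ : ∀ z ∈ chordStrip γ e, exp (M z) = γ z.1 - e z.2) (x p : ℝ) (_ : x ∈ Icc (0 : ℝ) 1)
      (_ : e x = γ p), ∃ k : ℤ, ∀ t, p < t → t < p + P →
        M (t, x) = L (p, t) + k * (2 * Real.pi * I) := by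
    intro e M hM hM' x p hx hxp
    have hmaps : ∀ t ∈ Ioo p (p + P), (t, x) ∈ chordStrip γ e := fun t ht =>
      ⟨hx, by simpa [hxp] using (hinj p t ht.1 ht.2).symm⟩
    have hmaps' : ∀ t ∈ Ioo p (p + P), (p, t) ∈ {z : ℝ × ℝ | z.1 < z.2 ∧ z.2 < z.1 + P} :=
      fun t ht => ⟨ht.1, ht.2⟩
    obtain ⟨k, hk⟩ := (isPreconnected_Ioo (a := p) (b := p + P)).eq_add_int_mul_of_exp_eq
      (f := fun t => M (t, x)) (g := fun t => L (p, t))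
      (hM.comp (by fun_prop) hmaps) (hL.comp (by fun_prop) hmaps') 0 (by
        intro t ht
        rw [add_zero, hM' _ (hmaps t ht), hL' _ (hmaps' t ht), hxp])
    exact ⟨k, fun t ht ht' => by simpa using hk t ⟨ht, ht'⟩⟩
  have hz0 : (0 : ℝ) ∈ Icc (0 : ℝ) 1 := by simp
  have hz1 : (1 : ℝ) ∈ Icc (0 : ℝ) 1 := by simp
  obtain ⟨k0, hk0⟩ := hend hMc hMc' 0 a hz0 hc0
  obtain ⟨k1, hk1⟩ := hend hMc hMc' 1 b hz1 hc1
  obtain ⟨l0, hl0⟩ := hend hMd hMd' 0 a' hz0 hd0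
  obtain ⟨l1, hl1⟩ := hend hMd hMd' 1 b' hz1 hd1
  -- comparison of a chord with the other chord
  have hsideC : ∀ p y : ℝ, y ∈ Icc (0 : ℝ) 1 → d y = γ p → ∃ n : ℤ, ∀ x ∈ Icc (0 : ℝ) 1,
      Mc (p, x) = N (x, y) + Real.pi * I + n * (2 * Real.pi * I) := by
    intro p y hy hyp
    have hmaps : ∀ x ∈ Icc (0 : ℝ) 1, (p, x) ∈ chordStrip γ c := fun x hx =>
      ⟨hx, by simpa [hyp] using (hcd x hx y hy).symm⟩
    have hmaps' : ∀ x ∈ Icc (0 : ℝ) 1, (x, y) ∈ Icc (0 : ℝ) 1 ×ˢ Icc (0 : ℝ) 1 :=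
      fun x hx => ⟨hx, hy⟩
    exact (isPreconnected_Icc (a := (0 : ℝ)) (b := 1)).eq_add_int_mul_of_exp_eq
      (f := fun x => Mc (p, x)) (g := fun x => N (x, y))
      (hMc.comp (by fun_prop) hmaps) (hN.comp (by fun_prop) hmaps') _ (by
        intro x hx
        rw [exp_add, exp_pi_mul_I, hMc' _ (hmaps x hx), hN' _ (hmaps' x hx), hyp]
        ring)
  have hsideD : ∀ p x : ℝ, x ∈ Icc (0 : ℝ) 1 → c x = γ p → ∃ n : ℤ, ∀ y ∈ Icc (0 : ℝ) 1,
      Md (p, y) = N (x, y) + 0 + n * (2 * Real.pi * I) := by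
    intro p x hx hxp
    have hmaps : ∀ y ∈ Icc (0 : ℝ) 1, (p, y) ∈ chordStrip γ d := fun y hy =>
      ⟨hy, by simpa [hxp] using (hcd x hx y hy)⟩
    have hmaps' : ∀ y ∈ Icc (0 : ℝ) 1, (x, y) ∈ Icc (0 : ℝ) 1 ×ˢ Icc (0 : ℝ) 1 :=
      fun y hy => ⟨hx, hy⟩
    exact (isPreconnected_Icc (a := (0 : ℝ)) (b := 1)).eq_add_int_mul_of_exp_eq
      (f := fun y => Md (p, y)) (g := fun y => N (x, y))
      (hMd.comp (by fun_prop) hmaps) (hN.comp (by fun_prop) hmaps') _ (by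
        intro y hy
        rw [add_zero, hMd' _ (hmaps y hy), hN' _ (hmaps' y hy), hxp])
  obtain ⟨n1, hn1⟩ := hsideC a' 0 hz0 hd0
  obtain ⟨n2, hn2⟩ := hsideC b' 1 hz1 hd1
  obtain ⟨n3, hn3⟩ := hsideD a 0 hz0 hc0
  obtain ⟨n4, hn4⟩ := hsideD b 1 hz1 hc1
  have hCa' : (a', (1 : ℝ)) ∈ chordStrip γ c :=
    ⟨hz1, by simpa [hd0] using (hcd 1 hz1 0 hz0).symm⟩
  have hDa0 : (a, (0 : ℝ)) ∈ chordStrip γ d :=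
    ⟨hz0, by simpa [hc0] using (hcd 0 hz0 0 hz0)⟩
  have hDa1 : (a, (1 : ℝ)) ∈ chordStrip γ d :=
    ⟨hz1, by simpa [hc0] using (hcd 0 hz0 1 hz1)⟩
  have hDb1 : (b, (1 : ℝ)) ∈ chordStrip γ d :=
    ⟨hz1, by simpa [hc1] using (hcd 1 hz1 1 hz1)⟩
  have e1 := hk0 a' (by linarith) (by linarith)
  have e2 := hk0 b' (by linarith) (by linarith)
  have e3 := hk1 b' (by linarith) (by linarith)
  have e4 := hk1 (a' + P) (by linarith) (by linarith)
  have e5 := hm a' b (by linarith) (by linarith)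
  have e6 := hv _ hCa'
  have f1 := hl0 b (by linarith) (by linarith)
  have f2 := hl0 (a + P) (by linarith) (by linarith)
  have f3 := hm a a' (by linarith) (by linarith)
  have f4 := hw _ hDa0
  have f5 := hl1 (a + P) (by linarith) (by linarith)
  have f6 := hm a b' (by linarith) (by linarith)
  have f7 := hw _ hDa1
  have f8 := hl1 (b + P) (by linarith) (by linarith)
  have f9 := hm b b' (by linarith) (by linarith)
  have f10 := hw _ hDb1
  have g1 := hn1 0 hz0
  have g2 := hn1 1 hz1
  have g3 := hn2 0 hz0
  have g4 := hn2 1 hz1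
  have g5 := hn3 0 hz0
  have g6 := hn3 1 hz1
  have g7 := hn4 0 hz0
  have g8 := hn4 1 hz1
  simp only at e6 f4 f7 f10
  -- The integers `k`, `l`, `n` of the comparisons cancel in pairs. The half turn `hm` survives with
  -- net coefficient two, contributing `2 * m + 1` full turns.
  have key : ((v + w : ℤ) : ℂ) * (2 * Real.pi * I) = ((2 * m + 1 : ℤ) : ℂ) * (2 * Real.pi * I) := by
    push_cast
    linear_combination (-1 : ℂ) * e1 + e2 - e3 + e4 + e5 - e6 - f1 + f2 + f3 - f4 - f5 - f6 + f7
      + f8 + f9 - f10 + g1 - g2 - g3 + g4 - g5 + g6 + g7 - g8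
  have h2 : (2 * Real.pi * I : ℂ) ≠ 0 := by simp [Real.pi_ne_zero]
  exact ⟨m, by exact_mod_cast mul_right_cancel₀ h2 key⟩

end Winding

/-! ### Intersections of halfcircles -/

section HalfCircles

open Set

/-- The closed halfcircle above (`σ = true`) or below (`σ = false`) the `x`-axis with endpoints
`(a, 0)` and `(b, 0)`. -/
def halfCircle (σ : Bool) (a b : ℝ) : Set (ℝ × ℝ) :=
  if σ then upperHalfCircle a b else lowerHalfCircle a b

theorem mem_halfCircle {σ : Bool} {a b : ℝ} {p : ℝ × ℝ} :
    p ∈ halfCircle σ a b ↔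
      p.2 ^ 2 = (p.1 - a) * (b - p.1) ∧ 0 ≤ (if σ then 1 else -1) * p.2 := by
  have h : (p.1 - (a + b) / 2) ^ 2 + p.2 ^ 2 = ((b - a) / 2) ^ 2 ↔
      p.2 ^ 2 = (p.1 - a) * (b - p.1) := by
    constructor <;> intro h <;> linear_combination h
  cases σ <;> simp [halfCircle, upperHalfCircle, lowerHalfCircle, h]

theorem halfCircle_comm (σ : Bool) (a b : ℝ) : halfCircle σ a b = halfCircle σ b a := by
  ext p
  rw [mem_halfCircle, mem_halfCircle, show (p.1 - a) * (b - p.1) = (p.1 - b) * (a - p.1) by ring]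

theorem right_mem_halfCircle (σ : Bool) (a b : ℝ) : (b, (0 : ℝ)) ∈ halfCircle σ a b := by
  simp [mem_halfCircle]

theorem eq_or_eq_of_mem_halfCircle {σ : Bool} {a b : ℝ} {p : ℝ × ℝ} (hp : p ∈ halfCircle σ a b)
    (h : p.2 = 0) : p.1 = a ∨ p.1 = b := by
  have := (mem_halfCircle.1 hp).1
  rw [h, zero_pow two_ne_zero, eq_comm, mul_eq_zero, sub_eq_zero, sub_eq_zero] at this
  exact this.imp_right Eq.symm

theorem snd_eq_zero_of_mem_halfCircle {σ τ : Bool} (h : σ ≠ τ) {a b c d : ℝ} {p : ℝ × ℝ}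
    (hp : p ∈ halfCircle σ a b) (hp' : p ∈ halfCircle τ c d) : p.2 = 0 := by
  have h1 := (mem_halfCircle.1 hp).2
  have h2 := (mem_halfCircle.1 hp').2
  cases σ <;> cases τ <;> simp_all <;> linarith

theorem mem_Icc_of_mem_halfCircle {σ : Bool} {a b : ℝ} (hab : a < b) {p : ℝ × ℝ}
    (hp : p ∈ halfCircle σ a b) : p.1 ∈ Icc a b := by
  have h := (mem_halfCircle.1 hp).1
  constructor <;> by_contra! hlt <;> nlinarith [sq_nonneg p.2]

/-- Halfcircles that are nested or side by side meet only on the spine. -/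
theorem snd_eq_zero_of_not_alternating {σ τ : Bool} {a b c d : ℝ} (hab : a < b) (hcd : c < d)
    (hne : a ≠ c ∨ b ≠ d) (h1 : ¬ (a < c ∧ c < b ∧ b < d)) (h2 : ¬ (c < a ∧ a < d ∧ d < b))
    {p : ℝ × ℝ} (hp : p ∈ halfCircle σ a b) (hp' : p ∈ halfCircle τ c d) : p.2 = 0 := by
  wlog hac : a < c ∨ (a = c ∧ d < b) generalizing a b c d σ τ
  · refine this hcd hab (by tauto) h2 h1 hp' hp ?_
    rcases lt_trichotomy a c with h | h | h
    · tauto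
    · right
      refine ⟨h.symm, lt_of_le_of_ne ?_ (by tauto)⟩
      by_contra! h'
      tauto
    · tauto
  obtain ⟨e1, -⟩ := mem_halfCircle.1 hp
  obtain ⟨e2, -⟩ := mem_halfCircle.1 hp'
  obtain ⟨i1, i2⟩ := mem_Icc_of_mem_halfCircle hab hp
  obtain ⟨j1, j2⟩ := mem_Icc_of_mem_halfCircle hcd hp'
  suffices p.2 ^ 2 = 0 from pow_eq_zero_iff two_ne_zero |>.1 this
  rcases hac with hac | ⟨rfl, hdb⟩
  · rcases le_or_gt b c with hbc | hbc
    · have : p.1 = b := by linarith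
      rw [e1, this]; ring
    · have hdb : d ≤ b := by
        by_contra! h
        exact h1 ⟨hac, hbc, h⟩
      -- Here `p.1 - a > p.1 - c ≥ 0` and `b - p.1 ≥ d - p.1 ≥ 0`, so the two products can only
      -- agree if `b - p.1` vanishes.
      have : b - p.1 = 0 := by nlinarith
      rw [e1, this]; ring
  · have : p.1 - a = 0 := by nlinarith
    rw [e1, this]; ring

/-- Halfcircles on the same side with alternating endpoints meet outside of the spine. -/
theorem exists_mem_halfCircle_of_alternating (σ : Bool) {a b c d : ℝ} (h1 : a < c) (h2 : c < b)
    (h3 : b < d) : ∃ p, p ∈ halfCircle σ a b ∧ p ∈ halfCircle σ c d ∧ p.2 ≠ 0 := by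
  have hs : 0 < c + d - a - b := by linarith
  -- The abscissa of the radical axis of the two circles.
  set x := (c * d - a * b) / (c + d - a - b) with hx
  have hxs : x * (c + d - a - b) = c * d - a * b := div_mul_cancel₀ _ hs.ne'
  have e : (x - a) * (b - x) = (x - c) * (d - x) := by linear_combination -hxs
  have ha : 0 < x - a := by
    have : (x - a) * (c + d - a - b) = (c - a) * (d - a) := by linear_combination hxs
    exact pos_of_mul_pos_left (this ▸ mul_pos (by linarith) (by linarith)) hs.le
  have hb : 0 < b - x := by
    have : (b - x) * (c + d - a - b) = (b - c) * (d - b) := by linear_combination -hxs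
    exact pos_of_mul_pos_left (this ▸ mul_pos (by linarith) (by linarith)) hs.le
  have hpos : 0 < (x - a) * (b - x) := mul_pos ha hb
  have hsq : Real.sqrt ((x - a) * (b - x)) ^ 2 = (x - a) * (b - x) := Real.sq_sqrt hpos.le
  have hspos := Real.sqrt_pos.2 hpos
  refine ⟨(x, (if σ then 1 else -1) * Real.sqrt ((x - a) * (b - x))), ?_, ?_, ?_⟩
  · rw [mem_halfCircle]
    cases σ <;> simp [hsq]
  · rw [mem_halfCircle]
    cases σ <;> simp [← e, hsq]
  · cases σ <;> simp [hspos.ne']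

theorem isJordanArc_halfCircle (σ : Bool) {a b : ℝ} (hab : a ≠ b) :
    IsJordanArc (halfCircle σ a b) (a, 0) (b, 0) := by
  let s : ℝ := if σ then 1 else -1
  have hs : s * s = 1 := by cases σ <;> simp [s]
  have key : ∀ t : ℝ, 0 ≤ t → t ≤ 1 → 0 ≤ (a + (b - a) * t - a) * (b - (a + (b - a) * t)) := by
    intro t h0 h1
    have := mul_nonneg (mul_nonneg h0 (sub_nonneg.2 h1)) (sq_nonneg (b - a))
    linarith
  refine ⟨⟨⟨fun t => (a + (b - a) * t,
      s * Real.sqrt ((a + (b - a) * t - a) * (b - (a + (b - a) * t)))), by fun_prop⟩,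
      by simp, by simp⟩, ?_, ?_⟩
  · intro t t' h
    have h1 := congrArg Prod.fst h
    simp only [Path.coe_mk_mk, add_right_inj, mul_eq_mul_left_iff, sub_eq_zero, hab.symm,
      or_false] at h1
    exact Subtype.ext h1
  · ext p
    constructor
    · rintro ⟨t, rfl⟩
      rw [mem_halfCircle]
      refine ⟨?_, ?_⟩
      · simp only [Path.coe_mk_mk, mul_pow]
        rw [Real.sq_sqrt (key t t.2.1 t.2.2), sq, hs, one_mul]
      · change 0 ≤ s * (s * Real.sqrt _)
        rw [← mul_assoc, hs, one_mul]
        exact Real.sqrt_nonneg _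
    · intro hp
      obtain ⟨h1, h2⟩ := mem_halfCircle.1 hp
      change 0 ≤ s * p.2 at h2
      have hba : b - a ≠ 0 := sub_ne_zero.2 hab.symm
      have e : a + (b - a) * ((p.1 - a) / (b - a)) = p.1 := by field_simp; ring
      have hmem : (p.1 - a) / (b - a) ∈ unitInterval := by
        rcases hab.lt_or_gt with h | h
        · obtain ⟨i, j⟩ := mem_Icc_of_mem_halfCircle h hp
          exact ⟨div_nonneg (by linarith) (by linarith),
            div_le_one_of_le₀ (by linarith) (by linarith)⟩
        · rw [halfCircle_comm] at hp
          obtain ⟨i, j⟩ := mem_Icc_of_mem_halfCircle h hp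
          exact ⟨div_nonneg_of_nonpos (by linarith) (by linarith),
            (div_le_one_of_neg (by linarith)).2 (by linarith)⟩
      refine ⟨⟨_, hmem⟩, ?_⟩
      simp only [Path.coe_mk_mk, e]
      refine Prod.ext rfl ?_
      simp only
      rw [← h1, show p.2 ^ 2 = (s * p.2) ^ 2 by rw [mul_pow, sq s, hs, one_mul],
        Real.sqrt_sq h2, ← mul_assoc, hs, one_mul]

end HalfCircles

/-! ### Concatenation of Jordan arcs -/

section JordanArcs

open Set

theorem IsJordanArc.symm {S : Set (ℝ × ℝ)} {p q : ℝ × ℝ} (h : IsJordanArc S p q) :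
    IsJordanArc S q p := by
  obtain ⟨γ, hγ, rfl⟩ := h
  exact ⟨γ.symm, hγ.comp unitInterval.symm_bijective.injective, γ.symm_range⟩

theorem IsJordanArc.union {S T : Set (ℝ × ℝ)} {p q r : ℝ × ℝ} (hS : IsJordanArc S p q)
    (hT : IsJordanArc T q r) (h : S ∩ T ⊆ {q}) : IsJordanArc (S ∪ T) p r := by
  obtain ⟨γ, hγ, rfl⟩ := hS
  obtain ⟨δ, hδ, rfl⟩ := hT
  refine ⟨γ.trans δ, ?_, γ.trans_range δ⟩
  have aux : ∀ s t : unitInterval, (s : ℝ) ≤ 1 / 2 → ¬ (t : ℝ) ≤ 1 / 2 →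
      γ.trans δ s ≠ γ.trans δ t := by
    intro s t hs ht hst
    rw [Path.trans_apply, Path.trans_apply, dif_pos hs, dif_neg ht] at hst
    have : δ ⟨2 * t - 1, unitInterval.two_mul_sub_one_mem_iff.2 ⟨(not_le.1 ht).le, t.2.2⟩⟩ = q :=
      h ⟨⟨_, hst⟩, ⟨_, rfl⟩⟩
    have h0 := hδ (this.trans δ.source.symm)
    have := congrArg Subtype.val h0
    simp at this
    linarith
  intro s t hst
  by_cases hs : (s : ℝ) ≤ 1 / 2 <;> by_cases ht : (t : ℝ) ≤ 1 / 2
  · rw [Path.trans_apply, Path.trans_apply, dif_pos hs, dif_pos ht] at hst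
    have := congrArg Subtype.val (hγ hst)
    simp at this
    exact Subtype.ext this
  · exact absurd hst (aux s t hs ht)
  · exact absurd hst.symm (aux t s ht hs)
  · rw [Path.trans_apply, Path.trans_apply, dif_neg hs, dif_neg ht] at hst
    have := congrArg Subtype.val (hδ hst)
    simp at this
    exact Subtype.ext this

end JordanArcs

/-! ### Two-page book embeddings: drawings and Hamiltonian augmentation -/

namespace SimpleGraph

universe u

/-- A two-page book embedding: the vertices are placed on a line and the edges are coloured so that
edges of the same colour do not cross. -/
structure IsTwoPage {W : Type u} (S : SimpleGraph W) (pos : W → ℝ) (col : Sym2 W → Bool) : Prop where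
  injective : Function.Injective pos
  col_ne : ∀ u v x y, S.Adj u v → S.Adj x y → pos u < pos x → pos x < pos v → pos v < pos y →
    col s(u, v) ≠ col s(x, y)

namespace IsTwoPage

variable {W : Type u} {S : SimpleGraph W} {pos : W → ℝ} {col : Sym2 W → Bool}

/-- Edges of different colours lie on different sides of the spine, and edges of the same colour are
nested or side by side. Either way a common point is on the spine, where a halfcircle has only its
endpoints. -/
theorem exists_eq_of_mem_halfCircle (h : S.IsTwoPage pos col) {u v x y : W} (huv : S.Adj u v)
    (hxy : S.Adj x y) (hne : s(u, v) ≠ s(x, y)) {p : ℝ × ℝ}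
    (hp : p ∈ halfCircle (col s(u, v)) (pos u) (pos v))
    (hp' : p ∈ halfCircle (col s(x, y)) (pos x) (pos y)) :
    ∃ w, w ∈ s(u, v) ∧ w ∈ s(x, y) ∧ p = (pos w, 0) := by
  have h0 : p.2 = 0 := by
    by_cases hc : col s(u, v) = col s(x, y)
    · wlog h1 : pos u < pos v generalizing u v
      · rw [Sym2.eq_swap (a := u), halfCircle_comm] at hp
        refine this huv.symm (by rwa [Sym2.eq_swap (a := v)]) hp
          (by rwa [Sym2.eq_swap (a := v)]) ?_
        exact lt_of_le_of_ne (not_lt.1 h1) (h.injective.ne huv.ne.symm)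
      wlog h2 : pos x < pos y generalizing x y
      · rw [Sym2.eq_swap (a := x), halfCircle_comm] at hp'
        refine this hxy.symm hp' (by rwa [Sym2.eq_swap (a := y)])
          (by rwa [Sym2.eq_swap (a := y)]) ?_
        exact lt_of_le_of_ne (not_lt.1 h2) (h.injective.ne hxy.ne.symm)
      refine snd_eq_zero_of_not_alternating h1 h2 ?_ ?_ ?_ hp hp'
      · by_contra! h'
        exact hne (by rw [h.injective h'.1, h.injective h'.2])
      · rintro ⟨i, j, k⟩
        exact h.col_ne u v x y huv hxy i j k hc
      · rintro ⟨i, j, k⟩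
        exact h.col_ne x y u v hxy huv i j k hc.symm
    · exact snd_eq_zero_of_mem_halfCircle hc hp hp'
  have h1 : ∃ w, w ∈ s(u, v) ∧ p.1 = pos w := by
    rcases eq_or_eq_of_mem_halfCircle hp h0 with e | e
    exacts [⟨u, by simp, e⟩, ⟨v, by simp, e⟩]
  have h2 : ∃ w, w ∈ s(x, y) ∧ p.1 = pos w := by
    rcases eq_or_eq_of_mem_halfCircle hp' h0 with e | e
    exacts [⟨x, by simp, e⟩, ⟨y, by simp, e⟩]
  obtain ⟨w, hw, e⟩ := h1
  obtain ⟨w', hw', e'⟩ := h2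
  obtain rfl := h.injective (e.symm.trans e')
  exact ⟨w, hw, hw', Prod.ext e h0⟩

/-- A two-page book embedding gives a plane drawing by halfcircles. -/
theorem exists_drawing (h : S.IsTwoPage pos col) : ∃ D : S.Drawing, D.IsPlane ∧
    (∀ w, D.point w = (pos w, 0)) ∧
    ∀ u v, D.arc s(u, v) = halfCircle (col s(u, v)) (pos u) (pos v) := by
  let A : Sym2 W → Set (ℝ × ℝ) := fun e => Sym2.lift
    ⟨fun u v => halfCircle (col s(u, v)) (pos u) (pos v), fun u v => by
      beta_reduce
      rw [Sym2.eq_swap (a := u), halfCircle_comm]⟩ e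
  refine ⟨⟨fun w => (pos w, 0), A, ?_, ?_, ?_⟩, ?_, fun w => rfl, fun u v => rfl⟩
  · intro u v huv
    exact h.injective (congrArg Prod.fst huv)
  · intro u v huv
    exact isJordanArc_halfCircle _ (h.injective.ne huv.ne)
  · intro e
    induction e using Sym2.ind with
    | _ u v =>
      intro _ w hw
      rcases eq_or_eq_of_mem_halfCircle hw rfl with e | e <;> simp [h.injective e]
  · intro e
    induction e using Sym2.ind with
    | _ u v =>
      intro he f
      induction f using Sym2.ind with
      | _ x y =>
        intro hf hne p hp
        exact h.exists_eq_of_mem_halfCircle he hf hne hp.1 hp.2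

theorem isPlanar (h : S.IsTwoPage pos col) : S.IsPlanar :=
  let ⟨D, hD, _⟩ := h.exists_drawing
  ⟨D, hD⟩

/-- A graph with a two-page book embedding is subhamiltonian. -/
theorem isSubhamiltonian [Fintype W] [DecidableEq W] (h : S.IsTwoPage pos col)
    (hW : 3 ≤ Fintype.card W) : S.IsSubhamiltonian := by
  obtain ⟨n, hn⟩ := Nat.exists_eq_add_of_le' hW
  let _ : LinearOrder W := LinearOrder.lift' pos h.injective
  have hlt : ∀ u v : W, u < v ↔ pos u < pos v := fun u v => Iff.rfl
  let φ : Fin (n + 3) ≃o W := monoEquivOfFin W hn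
  -- A cycle edge joins neighbours on the line or the two extremes. It alternates with no edge, so
  -- `col` needs no change on the added edges.
  have hcyc : ∀ {u v : W}, ((cycleGraph (n + 3)).map φ).Adj u v → u < v →
      (∀ x, u < x → ¬ x < v) ∨ ((∀ x, u ≤ x) ∧ ∀ x, x ≤ v) := by
    rintro u v ⟨-, i, j, hij, rfl, rfl⟩ huv
    replace huv : i < j := φ.lt_iff_lt.1 huv
    rw [cycleGraph_adj'] at hij
    have hcase : j.val = i.val + 1 ∨ (i.val = 0 ∧ j.val = n + 2) := by
      have hi := i.2
      have hj := j.2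
      rw [Fin.lt_def] at huv
      rcases hij with hij | hij
      · rw [Fin.coe_sub_iff_lt.2 huv] at hij
        omega
      · rw [Fin.coe_sub_iff_le.2 huv.le] at hij
        omega
    rcases hcase with hc | ⟨h0, h1⟩
    · left
      intro x h1 h2
      obtain ⟨k, rfl⟩ := φ.surjective x
      have h1' : i < k := φ.lt_iff_lt.1 h1
      have h2' : k < j := φ.lt_iff_lt.1 h2
      rw [Fin.lt_def] at h1' h2'
      omega
    · right
      constructor <;> intro x <;> obtain ⟨k, rfl⟩ := φ.surjective x
      · exact φ.le_iff_le.2 (by rw [Fin.le_def]; omega)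
      · exact φ.le_iff_le.2 (by rw [Fin.le_def]; omega)
  refine ⟨S ⊔ (cycleGraph (n + 3)).map φ, le_sup_left, ?_, ?_⟩
  · refine IsTwoPage.isPlanar (pos := pos) (col := col) ⟨h.injective, ?_⟩
    rintro u v x y huv hxy i j k
    rw [← hlt] at i j k
    rcases huv with huv | huv
    · rcases hxy with hxy | hxy
      · exact h.col_ne u v x y huv hxy i j k
      · rcases hcyc hxy (j.trans k) with h' | h'
        · exact absurd k (h' _ j)
        · exact absurd i (h'.1 _).not_gt
    · rcases hcyc huv (i.trans j) with h' | h'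
      · exact absurd j (h' _ i)
      · exact absurd k (h'.2 _).not_gt
  · refine IsHamiltonian.mono (G := (cycleGraph (n + 3)).map φ) le_sup_right ?_
    intro _
    refine ⟨_, (cycleGraph.cycle n).map (Iso.map φ.toEquiv _).toHom, ?_⟩
    rw [Walk.isHamiltonianCycle_iff_isCycle_and_length_eq]
    exact ⟨cycleGraph.isCycle_cycle.map (Iso.map φ.toEquiv _).injective, by
      rw [Walk.length_map, cycleGraph.length_cycle, hn]⟩

end IsTwoPage

end SimpleGraph

/-! ### From planar Hamiltonian graphs to book embeddings -/

/-- Paths indexed by the integers that fit together can be concatenated. -/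
theorem continuous_floor_fract {X : Type*} [TopologicalSpace X] {f : ℤ → ℝ → X}
    (hf : ∀ i, Continuous (f i)) (h : ∀ i, f i 1 = f (i + 1) 0) :
    Continuous fun t : ℝ => f ⌊t⌋ (Int.fract t) := by
  have hIcc : ∀ i : ℤ, ContinuousOn (fun t : ℝ => f ⌊t⌋ (Int.fract t)) (Set.Icc (i : ℝ) (i + 1)) := by
    intro i
    refine ContinuousOn.congr (f := fun t : ℝ => f i (t - i))
      ((hf i).comp (by fun_prop)).continuousOn ?_
    rintro t ⟨h1, h2⟩
    rcases h2.eq_or_lt with rfl | h2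
    · have : ⌊(i : ℝ) + 1⌋ = i + 1 := by simp
      simp [this, h]
    · have : ⌊t⌋ = i := Int.floor_eq_iff.2 ⟨h1, h2⟩
      simp [this, Int.fract]
  rw [continuous_iff_continuousAt]
  intro t
  -- Two adjacent unit intervals are needed to cover a neighbourhood of an integer `t`.
  have hu := (hIcc (⌊t⌋ - 1)).union_of_isClosed (hIcc ⌊t⌋) isClosed_Icc isClosed_Icc
  refine hu.continuousAt ?_
  push_cast
  rw [sub_add_cancel, Set.Icc_union_Icc_eq_Icc (by linarith) (by linarith)]
  exact Icc_mem_nhds (by linarith [Int.floor_le t]) (Int.lt_floor_add_one t)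

namespace SimpleGraph

universe u

variable {W : Type u} {H : SimpleGraph W}

/-- Indexing the cycle periodically by all integers removes the special case of the closing edge and
matches a closed curve parametrized by `ℝ`. -/
theorem Walk.IsHamiltonianCycle.exists_enumeration [DecidableEq W] {a : W} {p : H.Walk a a}
    (hp : p.IsHamiltonianCycle) : ∃ n : ℕ, 3 ≤ n ∧ ∃ v : ℤ → W, (∀ i, H.Adj (v i) (v (i + 1))) ∧
      (∀ i j, v i = v j ↔ (n : ℤ) ∣ i - j) ∧ ∀ w, ∃ i : ℤ, 0 ≤ i ∧ i < n ∧ v i = w := by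
  have h3 := hp.isCycle.three_le_length
  have hn : (0 : ℤ) < p.length := by omega
  refine ⟨p.length, h3, fun i => p.getVert (i % p.length).toNat, ?_, ?_, ?_⟩
  · intro i
    have h0 := Int.emod_nonneg i hn.ne'
    have h1 := Int.emod_lt_of_pos i hn
    have hadj := p.adj_getVert_succ (i := (i % p.length).toNat) (by omega)
    rcases eq_or_ne (i % p.length) (p.length - 1) with h | h
    · have e : (i + 1) % p.length = 0 := by
        rw [← Int.emod_add_emod, h]
        simp
      have e' : (i % p.length).toNat + 1 = p.length := by omega
      rw [e', p.getVert_length] at hadj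
      simpa [e] using hadj
    · have e : (i + 1) % p.length = i % p.length + 1 := by
        rw [← Int.emod_add_emod]
        exact Int.emod_eq_of_lt (by omega) (by omega)
      have e' : ((i + 1) % p.length).toNat = (i % p.length).toNat + 1 := by omega
      beta_reduce
      rwa [e']
  · intro i j
    have hi := Int.emod_nonneg i hn.ne'
    have hi' := Int.emod_lt_of_pos i hn
    have hj := Int.emod_nonneg j hn.ne'
    have hj' := Int.emod_lt_of_pos j hn
    rw [← Int.emod_eq_emod_iff_emod_sub_eq_zero.trans Int.dvd_iff_emod_eq_zero.symm]
    constructor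
    · intro h
      have := hp.isCycle.getVert_injOn' (by simp only [Set.mem_ofPred_eq]; omega)
        (by simp only [Set.mem_ofPred_eq]; omega) h
      omega
    · intro h
      simp only [h]
  · intro w
    obtain ⟨m, hm, hle⟩ := Walk.mem_support_iff_exists_getVert.1 (hp.mem_support w)
    rcases hle.eq_or_lt with rfl | hlt
    · refine ⟨0, le_rfl, hn, ?_⟩
      rw [p.getVert_length] at hm
      simp [hm]
    · refine ⟨m, by omega, by omega, ?_⟩
      beta_reduce
      rw [Int.emod_eq_of_lt (by omega) (by omega)]
      simpa using hm

/-- The parametrizations of an edge in its two directions are chosen independently. Colours will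
therefore refer to the direction of increasing position. -/
theorem Drawing.exists_parametrization (D : H.Drawing) : ∃ g : W → W → ℝ → ℂ, ∀ u v, H.Adj u v →
    Continuous (g u v) ∧ Set.InjOn (g u v) (Set.Icc 0 1) ∧
    g u v 0 = Complex.equivRealProdCLM.symm (D.point u) ∧
    g u v 1 = Complex.equivRealProdCLM.symm (D.point v) ∧
    ∀ x ∈ Set.Icc (0 : ℝ) 1, Complex.equivRealProdCLM (g u v x) ∈ D.arc s(u, v) := by
  have : ∀ u v, ∃ g : ℝ → ℂ, H.Adj u v →
      Continuous g ∧ Set.InjOn g (Set.Icc 0 1) ∧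
      g 0 = Complex.equivRealProdCLM.symm (D.point u) ∧
      g 1 = Complex.equivRealProdCLM.symm (D.point v) ∧
      ∀ x ∈ Set.Icc (0 : ℝ) 1, Complex.equivRealProdCLM (g x) ∈ D.arc s(u, v) := by
    intro u v
    by_cases huv : H.Adj u v
    · obtain ⟨γ, hγ, hr⟩ := D.isJordanArc u v huv
      refine ⟨fun x => Complex.equivRealProdCLM.symm (γ.extend x), fun _ =>
        ⟨by fun_prop, ?_, by simp, by simp, ?_⟩⟩
      · intro x hx y hy hxy
        have := Complex.equivRealProdCLM.symm.injective hxy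
        rw [γ.extend_apply hx, γ.extend_apply hy] at this
        exact congrArg Subtype.val (hγ this)
      · intro x hx
        rw [ContinuousLinearEquiv.apply_symm_apply, γ.extend_apply hx, ← hr]
        exact ⟨_, rfl⟩
    · exact ⟨0, fun h => absurd h huv⟩
  choose g hg using this
  exact ⟨g, hg⟩

/-- A planar Hamiltonian graph has a two-page book embedding: the vertices are ordered along the
Hamiltonian cycle, and an edge is coloured according to the side of the cycle on which it lies. -/
theorem IsPlanar.exists_isTwoPage [Fintype W] [DecidableEq W] (hpl : H.IsPlanar)
    (hH : H.IsHamiltonian) (hW : Fintype.card W ≠ 1) : ∃ pos col, H.IsTwoPage pos col := by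
  classical
  obtain ⟨D, hD⟩ := hpl
  obtain ⟨a, p, hp⟩ := hH hW
  obtain ⟨n, hn, v, hadj, hv, hsurj⟩ := hp.exists_enumeration
  obtain ⟨g, hg⟩ := D.exists_parametrization
  -- common points of edges
  have hmeet : ∀ {u w x y s t}, H.Adj u w → H.Adj x y → s(u, w) ≠ s(x, y) →
      s ∈ Set.Icc (0 : ℝ) 1 → t ∈ Set.Icc (0 : ℝ) 1 → g u w s = g x y t →
      ∃ z, z ∈ s(u, w) ∧ z ∈ s(x, y) ∧ g u w s = Complex.equivRealProdCLM.symm (D.point z) := by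
    intro u w x y s t huw hxy hne hs ht h
    obtain ⟨z, hz, hz', e⟩ := hD _ huw _ hxy hne _
      ⟨(hg _ _ huw).2.2.2.2 s hs, h ▸ (hg _ _ hxy).2.2.2.2 t ht⟩
    exact ⟨z, hz, hz', by rw [← e, ContinuousLinearEquiv.symm_apply_apply]⟩
  have hend : ∀ {u w z s}, H.Adj u w → s ∈ Set.Icc (0 : ℝ) 1 → z ∈ s(u, w) →
      g u w s = Complex.equivRealProdCLM.symm (D.point z) → s = 0 ∧ z = u ∨ s = 1 ∧ z = w := by
    intro u w z s huw hs hz h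
    obtain ⟨-, hi, h0, h1, -⟩ := hg u w huw
    rcases Sym2.mem_iff.1 hz with rfl | rfl
    · exact Or.inl ⟨hi hs (by simp) (h.trans h0.symm), rfl⟩
    · exact Or.inr ⟨hi hs (by simp) (h.trans h1.symm), rfl⟩
  -- the Hamiltonian cycle as a closed curve
  set γ : ℝ → ℂ := fun t => g (v ⌊t⌋) (v (⌊t⌋ + 1)) (Int.fract t) with hγ_def
  have hfr : ∀ t : ℝ, Int.fract t ∈ Set.Icc (0 : ℝ) 1 := fun t =>
    ⟨Int.fract_nonneg t, (Int.fract_lt_one t).le⟩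
  have hγ : Continuous γ := continuous_floor_fract (f := fun i => g (v i) (v (i + 1)))
    (fun i => (hg _ _ (hadj i)).1) fun i => by
      rw [(hg _ _ (hadj i)).2.2.2.1, (hg _ _ (hadj (i + 1))).2.2.1]
  have hvn : ∀ i : ℤ, v (i + n) = v i := fun i => (hv _ _).2 (by simp)
  have hper : ∀ t, γ (t + n) = γ t := by
    intro t
    have e : ⌊t + n⌋ = ⌊t⌋ + n := Int.floor_add_natCast t n
    have e' : ⌊t⌋ + (n : ℤ) + 1 = (⌊t⌋ + 1) + n := by ring
    simp only [hγ_def, e, Int.fract_add_natCast, e', hvn]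
  have hγv : ∀ i : ℤ, γ i = Complex.equivRealProdCLM.symm (D.point (v i)) := by
    intro i
    simp only [hγ_def, Int.floor_intCast, Int.fract_intCast]
    exact (hg _ _ (hadj i)).2.2.1
  have hinj : ∀ s t : ℝ, s < t → t < s + n → γ s ≠ γ t := by
    intro s t hst hts h
    by_cases hd : (n : ℤ) ∣ ⌊s⌋ - ⌊t⌋
    · have e1 := (hv _ _).2 hd
      have e2 : v (⌊s⌋ + 1) = v (⌊t⌋ + 1) := (hv _ _).2 (by simpa using hd)
      simp only [hγ_def, e1, e2] at h
      have e3 := (hg _ _ (hadj ⌊t⌋)).2.1 (hfr s) (hfr t) h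
      have e4 : ((⌊t⌋ - ⌊s⌋ : ℤ) : ℝ) = t - s := by
        push_cast
        rw [Int.fract, Int.fract] at e3
        linarith
      have h1 : 0 < ⌊t⌋ - ⌊s⌋ := by
        have : (0 : ℝ) < ((⌊t⌋ - ⌊s⌋ : ℤ) : ℝ) := by rw [e4]; linarith
        exact_mod_cast this
      have h2 : ⌊t⌋ - ⌊s⌋ < n := by
        have : ((⌊t⌋ - ⌊s⌋ : ℤ) : ℝ) < ((n : ℤ) : ℝ) := by rw [e4]; push_cast; linarith
        exact_mod_cast this
      have h3 : (n : ℤ) ∣ ⌊t⌋ - ⌊s⌋ := by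
        rw [← neg_sub]
        exact hd.neg_right
      exact absurd (Int.le_of_dvd h1 h3) (not_le.2 h2)
    · have hne : s(v ⌊s⌋, v (⌊s⌋ + 1)) ≠ s(v ⌊t⌋, v (⌊t⌋ + 1)) := by
        intro he
        rcases Sym2.eq_iff.1 he with ⟨h1, -⟩ | ⟨h1, h2⟩
        · exact hd ((hv _ _).1 h1)
        -- A cycle edge repeated backwards would force `n ∣ 2`, against `3 ≤ n`.
        · have h3 := dvd_sub ((hv _ _).1 h2) ((hv _ _).1 h1)
          have h4 : ⌊s⌋ + 1 - ⌊t⌋ - (⌊s⌋ - (⌊t⌋ + 1)) = 2 := by ring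
          rw [h4] at h3
          have := Int.le_of_dvd (by norm_num) h3
          omega
      obtain ⟨z, hz, hz', e⟩ := hmeet (hadj _) (hadj _) hne (hfr s) (hfr t) h
      have h1 : z = v ⌊s⌋ := ((hend (hadj _) (hfr s) hz e).resolve_right
        fun h => (Int.fract_lt_one s).ne h.1).2
      have h2 : z = v ⌊t⌋ := ((hend (hadj _) (hfr t) hz' (Eq.trans (Eq.symm h) e)).resolve_right
        fun h => (Int.fract_lt_one t).ne h.1).2
      exact hd ((hv _ _).1 (h1.symm.trans h2))
  -- positions and colours
  choose k hk0 hkn hvk using hsurj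
  have hkinj : Function.Injective k := fun x y h => by rw [← hvk x, ← hvk y, h]
  have hwind : ∀ u w, ∃ m : ℤ, H.Adj u w → (∀ i, s(v i, v (i + 1)) ≠ s(u, w)) →
      HasChordWinding γ n (g u w) m := by
    intro u w
    by_cases huw : H.Adj u w ∧ ∀ i, s(v i, v (i + 1)) ≠ s(u, w)
    · obtain ⟨m, hm⟩ := exists_hasChordWinding (c := g u w) hγ hper (hg _ _ huw.1).1.continuousOn (by
        intro t x hx h
        have hx' := Set.Ioo_subset_Icc_self hx
        obtain ⟨z, hz, hz', e⟩ := hmeet (hadj ⌊t⌋) huw.1 (huw.2 _) (hfr t) hx' h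
        have h' : g u w x = _ := h.symm.trans e
        rcases hend huw.1 hx' hz' h' with ⟨h, -⟩ | ⟨h, -⟩
        · exact hx.1.ne' h
        · exact hx.2.ne h)
      exact ⟨m, fun _ _ => hm⟩
    · exact ⟨0, fun h h' => absurd ⟨h, h'⟩ huw⟩
  choose ω hω using hwind
  let col : Sym2 W → Bool := fun e => decide (∃ u w, e = s(u, w) ∧ k u < k w ∧ Even (ω u w))
  have hcol : ∀ u w, k u < k w → (col s(u, w) = true ↔ Even (ω u w)) := by
    intro u w huw
    simp only [col, decide_eq_true_eq]
    constructor
    · rintro ⟨x, y, h, hxy, he⟩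
      rcases Sym2.eq_iff.1 h with ⟨rfl, rfl⟩ | ⟨rfl, rfl⟩
      · exact he
      · exact absurd huw hxy.not_gt
    · intro h
      exact ⟨u, w, rfl, huw, h⟩
  refine ⟨fun w => k w, col, fun x y h => hkinj (by exact_mod_cast h), ?_⟩
  intro u w x y huw hxy h1 h2 h3
  have i1 : k u < k x := by exact_mod_cast h1
  have i2 : k x < k w := by exact_mod_cast h2
  have i3 : k w < k y := by exact_mod_cast h3
  -- Endpoints at cyclic distance at least two do not form a cycle edge; alternation ensures this
  -- distance.
  have hchord : ∀ {u w}, 2 ≤ k w - k u → k w - k u + 2 ≤ n → ∀ i, s(v i, v (i + 1)) ≠ s(u, w) := by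
    intro u w hl hr i he
    rw [← hvk u, ← hvk w] at he
    rcases Sym2.eq_iff.1 he with ⟨e1, e2⟩ | ⟨e1, e2⟩
    · have h3 := dvd_sub ((hv _ _).1 e1) ((hv _ _).1 e2)
      rw [show i - k u - (i + 1 - k w) = k w - k u - 1 by ring] at h3
      have := Int.le_of_dvd (by omega) h3
      omega
    · have h3 := dvd_sub ((hv _ _).1 e2) ((hv _ _).1 e1)
      rw [show i + 1 - k u - (i - k w) = k w - k u + 1 by ring] at h3
      have := Int.le_of_dvd (by omega) h3
      omega
  have c1 := hω u w huw (hchord (by omega) (by have := hkn y; have := hk0 u; omega))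
  have c2 := hω x y hxy (hchord (by omega) (by have := hkn y; have := hk0 u; omega))
  have hodd : Odd (ω u w + ω x y) := by
    refine HasChordWinding.odd_add hγ hper hinj h1 h2 h3 ?_ (hg _ _ huw).1.continuousOn
      (hg _ _ hxy).1.continuousOn ?_ ?_ ?_ ?_ ?_ c1 c2
    · have := hkn y
      have := hk0 u
      have : k y < k u + n := by omega
      exact_mod_cast this
    · rw [hγv, hvk, (hg _ _ huw).2.2.1]
    · rw [hγv, hvk, (hg _ _ huw).2.2.2.1]
    · rw [hγv, hvk, (hg _ _ hxy).2.2.1]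
    · rw [hγv, hvk, (hg _ _ hxy).2.2.2.1]
    · have hdisj : ∀ z, z ∈ s(u, w) → z ∉ s(x, y) := by
        intro z hz hz'
        rcases Sym2.mem_iff.1 hz with rfl | rfl <;> rcases Sym2.mem_iff.1 hz' with rfl | rfl <;>
          omega
      intro s hs t ht h
      obtain ⟨z, hz, hz', -⟩ := hmeet huw hxy (fun e => hdisj u (by simp) (e ▸ by simp)) hs ht h
      exact hdisj z hz hz'
  intro he
  have := hcol u w (by omega)
  rw [he, hcol x y (by omega)] at this
  rw [Int.odd_add, ← Int.not_even_iff_odd] at hodd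
  tauto

end SimpleGraph

/-! ### Suppressing subdivision vertices -/

namespace SimpleGraph

universe u

namespace IsTwoPage

variable {W : Type u} {S : SimpleGraph W} {pos : W → ℝ} {col : Sym2 W → Bool}

/-- The sign condition expresses alternation without fixing the order of the endpoints of either
edge, and such signs can be multiplied when a path is contracted. -/
theorem col_ne_of_alternating (h : S.IsTwoPage pos col) {u v x y : W} (huv : S.Adj u v)
    (hxy : S.Adj x y)
    (hneg : (pos x - pos u) * (pos x - pos v) * ((pos y - pos u) * (pos y - pos v)) < 0) :
    col s(u, v) ≠ col s(x, y) := by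
  wlog h1 : pos u < pos v generalizing u v
  · rw [Sym2.eq_swap (a := u)]
    exact this huv.symm (by linarith)
      (lt_of_le_of_ne (not_lt.1 h1) (h.injective.ne huv.ne.symm))
  wlog h2 : pos x < pos y generalizing x y
  · rw [Sym2.eq_swap (a := x)]
    exact this hxy.symm (by linarith)
      (lt_of_le_of_ne (not_lt.1 h2) (h.injective.ne hxy.ne.symm))
  rcases mul_neg_iff.1 hneg with ⟨hx, hy⟩ | ⟨hx, hy⟩
  · have h3 : pos u < pos y ∧ pos y < pos v := by
      constructor <;> by_contra! <;> nlinarith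
    have h4 : pos x < pos u := by by_contra! hc; nlinarith
    exact (h.col_ne x y u v hxy huv h4 h3.1 h3.2).symm
  · have h3 : pos u < pos x ∧ pos x < pos v := by
      constructor <;> by_contra! <;> nlinarith
    have h4 : pos v < pos y := by by_contra! hc; nlinarith
    exact h.col_ne u v x y huv hxy h3.1 h3.2 h4

/-- Paths of two edges of the same colour through a vertex of degree two can be replaced by single
edges of that colour. -/
theorem contract (h : S.IsTwoPage pos col) {W' : Type u} {S' : SimpleGraph W'} {ι : W' → W}
    (hι : Function.Injective ι)
    (hS : ∀ u v, S'.Adj u v → ¬ S.Adj (ι u) (ι v) → ∃ m, m ∉ Set.range ι ∧ S.Adj (ι u) m ∧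
      S.Adj (ι v) m ∧ col s(ι u, m) = col s(ι v, m) ∧ ∀ z, S.Adj z m → z = ι u ∨ z = ι v) :
    ∃ col' : Sym2 W' → Bool, S'.IsTwoPage (pos ∘ ι) col' ∧
      ∀ u v, S'.Adj u v → S.Adj (ι u) (ι v) → col' s(u, v) = col s(ι u, ι v) := by
  have hex : ∀ e : Sym2 W', ∃ σ : Bool, ∀ u v, e = s(u, v) → S'.Adj u v →
      (S.Adj (ι u) (ι v) → σ = col s(ι u, ι v)) ∧ (¬ S.Adj (ι u) (ι v) →
        ∃ m, m ∉ Set.range ι ∧ S.Adj (ι u) m ∧ S.Adj (ι v) m ∧ σ = col s(ι u, m) ∧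
          σ = col s(ι v, m) ∧ ∀ z, S.Adj z m → z = ι u ∨ z = ι v) := by
    intro e
    induction e using Sym2.ind with
    | _ x y =>
      by_cases hxy : S'.Adj x y
      · by_cases hS' : S.Adj (ι x) (ι y)
        · refine ⟨col s(ι x, ι y), fun u v he _ => ?_⟩
          rcases Sym2.eq_iff.1 he with ⟨rfl, rfl⟩ | ⟨rfl, rfl⟩
          · exact ⟨fun _ => rfl, fun h => absurd hS' h⟩
          · exact ⟨fun _ => by rw [Sym2.eq_swap], fun h => absurd hS'.symm h⟩
        · obtain ⟨m, h1, h2, h3, h4, h5⟩ := hS x y hxy hS'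
          refine ⟨col s(ι x, m), fun u v he _ => ?_⟩
          rcases Sym2.eq_iff.1 he with ⟨rfl, rfl⟩ | ⟨rfl, rfl⟩
          · exact ⟨fun h => absurd h hS', fun _ => ⟨m, h1, h2, h3, rfl, h4, h5⟩⟩
          · exact ⟨fun h => absurd h.symm hS',
              fun _ => ⟨m, h1, h3, h2, h4, rfl, fun z hz => (h5 z hz).symm⟩⟩
      · refine ⟨true, fun u v he huv => absurd ?_ hxy⟩
        rwa [← mem_edgeSet, he]
  choose col' hcol' using hex
  -- an edge crossing a contracted path crosses one of its two edges
  have hstep : ∀ {a b c d m : ℝ}, c ≠ m → d ≠ m → (c - a) * (c - b) * ((d - a) * (d - b)) < 0 →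
      (c - a) * (c - m) * ((d - a) * (d - m)) < 0 ∨
        (c - b) * (c - m) * ((d - b) * (d - m)) < 0 := by
    intro a b c d m hc hd hneg
    by_contra! hcon
    -- The product of the two candidates is the given negative number times the square of `(c - m) *
    -- (d - m)`.
    have h1 := mul_nonneg hcon.1 hcon.2
    have h2 : 0 < ((c - m) * (d - m)) ^ 2 := by
      have := mul_ne_zero (sub_ne_zero.2 hc) (sub_ne_zero.2 hd)
      positivity
    nlinarith [mul_neg_of_neg_of_pos hneg h2]
  have hsymm : ∀ a b c d : ℝ, (c - a) * (c - b) * ((d - a) * (d - b)) =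
      (a - c) * (a - d) * ((b - c) * (b - d)) := by
    intros
    ring
  -- an edge of `S` and an edge of `S'`
  have hone : ∀ {p q x y}, S.Adj p q → S'.Adj x y →
      (pos (ι x) - pos p) * (pos (ι x) - pos q) * ((pos (ι y) - pos p) * (pos (ι y) - pos q)) < 0 →
      (∀ m, m ∉ Set.range ι → S.Adj (ι x) m → S.Adj (ι y) m → m ≠ p ∧ m ≠ q) →
      col s(p, q) ≠ col' s(x, y) := by
    intro p q x y hpq hxy hneg hm
    by_cases hS' : S.Adj (ι x) (ι y)
    · rw [(hcol' _ x y rfl hxy).1 hS']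
      exact h.col_ne_of_alternating hpq hS' hneg
    · obtain ⟨m, h1, h2, h3, h4, h5, -⟩ := (hcol' _ x y rfl hxy).2 hS'
      obtain ⟨hp, hq⟩ := hm m h1 h2 h3
      rw [hsymm] at hneg
      rcases hstep (h.injective.ne hp.symm) (h.injective.ne hq.symm) hneg with hn | hn
      · rw [h4]
        exact (h.col_ne_of_alternating h2 hpq hn).symm
      · rw [h5]
        exact (h.col_ne_of_alternating h3 hpq hn).symm
  refine ⟨col', ⟨h.injective.comp hι, ?_⟩, fun u v huv hS' => (hcol' _ u v rfl huv).1 hS'⟩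
  intro u v x y huv hxy h1 h2 h3
  have hneg : (pos (ι x) - pos (ι u)) * (pos (ι x) - pos (ι v)) *
      ((pos (ι y) - pos (ι u)) * (pos (ι y) - pos (ι v))) < 0 := by
    simp only [Function.comp_apply] at h1 h2 h3
    exact mul_neg_of_neg_of_pos (mul_neg_of_pos_of_neg (by linarith) (by linarith))
      (mul_pos (by linarith) (by linarith))
  by_cases hS' : S.Adj (ι u) (ι v)
  · rw [(hcol' _ u v rfl huv).1 hS']
    exact hone hS' hxy hneg fun m hm _ _ => ⟨fun e => hm ⟨u, e.symm⟩, fun e => hm ⟨v, e.symm⟩⟩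
  · obtain ⟨m, g1, g2, g3, g4, g5, g6⟩ := (hcol' _ u v rfl huv).2 hS'
    -- Two contracted paths through the same `m` would share an endpoint, as `m` has no other
    -- neighbours; alternation excludes this.
    have hm : ∀ m', m' ∉ Set.range ι → S.Adj (ι x) m' → S.Adj (ι y) m' → m' ≠ m := by
      rintro m' - hx - rfl
      rcases g6 _ hx with e | e <;> rw [e] at hneg <;> simp at hneg
    rcases hstep (h.injective.ne fun e => g1 ⟨x, e⟩) (h.injective.ne fun e => g1 ⟨y, e⟩) hneg
      with hn | hn
    · rw [g4]
      exact hone g2 hxy hn fun m' i j k => ⟨fun e => i ⟨u, e.symm⟩, hm m' i j k⟩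
    · rw [g5]
      exact hone g3 hxy hn fun m' i j k => ⟨fun e => i ⟨v, e.symm⟩, hm m' i j k⟩

end IsTwoPage

variable {V : Type u} {G : SimpleGraph V} {F : Finset (Sym2 V)}

/-- The subdivision vertices whose two edges have the same colour can be suppressed. -/
theorem IsTwoPage.exists_subset_col_ne [DecidableEq V] {pos : V ⊕ F → ℝ}
    {col : Sym2 (V ⊕ F) → Bool} (h : (G.subdivide F).IsTwoPage pos col) :
    ∃ F' ⊆ F, ∃ (pos' : V ⊕ F' → ℝ) (col' : Sym2 (V ⊕ F') → Bool),
      (G.subdivide F').IsTwoPage pos' col' ∧ ∀ (e : F') (u v : V), e.1 = s(u, v) →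
        col' s(Sum.inl u, Sum.inr e) ≠ col' s(Sum.inl v, Sum.inr e) := by
  classical
  let F' : Finset (Sym2 V) := F.filter fun e => ∃ h : e ∈ F, ∃ u v, e = s(u, v) ∧
    col s(Sum.inl u, Sum.inr ⟨e, h⟩) ≠ col s(Sum.inl v, Sum.inr ⟨e, h⟩)
  have hF' : F' ⊆ F := Finset.filter_subset _ _
  let ι : V ⊕ F' → V ⊕ F := Sum.map id fun e => ⟨e.1, hF' e.2⟩
  have hι : Function.Injective ι := Function.injective_id.sumMap fun e f hef =>
    Subtype.ext (congrArg (fun z : F => z.1) hef)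
  -- The edges to be restored are those of `F` outside `F'`, whose two halves have equal colours.
  obtain ⟨col', hcol', hc⟩ := h.contract (S' := G.subdivide F') hι (by
    rintro (u | e) (v | f) huv hS
    · have hF : s(u, v) ∈ F := by
        by_contra hF
        exact hS ⟨huv.1, hF⟩
      refine ⟨Sum.inr ⟨s(u, v), hF⟩, ?_, Sym2.mem_mk_left u v, Sym2.mem_mk_right u v, ?_, ?_⟩
      · rintro ⟨w | e, hw⟩
        · cases hw
        · have : e.1 = s(u, v) := congrArg (fun z : F => z.1) (Sum.inr.inj hw)
          exact huv.2 (this ▸ e.2)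
      · by_contra hne
        exact huv.2 (Finset.mem_filter.2 ⟨hF, hF, u, v, rfl, hne⟩)
      · rintro (z | z) hz
        · rcases Sym2.mem_iff.1 hz with rfl | rfl
          exacts [Or.inl rfl, Or.inr rfl]
        · exact hz.elim
    · exact absurd huv hS
    · exact absurd huv hS
    · exact huv.elim)
  refine ⟨F', hF', _, col', hcol', ?_⟩
  intro e u v he
  obtain ⟨-, hF, x, y, hxy, hne⟩ := Finset.mem_filter.1 e.2
  have hu : u ∈ e.1 := he ▸ Sym2.mem_mk_left u v
  have hv : v ∈ e.1 := he ▸ Sym2.mem_mk_right u v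
  rw [hc (Sum.inl u) (Sum.inr e) hu hu, hc (Sum.inl v) (Sum.inr e) hv hv]
  rw [he] at hxy
  rcases Sym2.eq_iff.1 hxy with ⟨rfl, rfl⟩ | ⟨rfl, rfl⟩
  exacts [hne, hne.symm]

end SimpleGraph

/-! ### Biarcs as pairs of halfcircles -/

/-- Nondegenerate halfcircles leave the spine. Hence no proper arc is also counted as a biarc. -/
theorem IsBiarc.exists_pos_and_neg {S : Set (ℝ × ℝ)} {a b : ℝ} (h : IsBiarc S a b) :
    (∃ p ∈ S, 0 < p.2) ∧ ∃ p ∈ S, p.2 < 0 := by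
  have hup : ∀ {c d : ℝ}, c ≠ d → ((c + d) / 2, |d - c| / 2) ∈ upperHalfCircle c d ∧
      0 < |d - c| / 2 := by
    intro c d hcd
    have : 0 < |d - c| := abs_pos.2 (sub_ne_zero.2 hcd.symm)
    exact ⟨⟨by simp [div_pow], by positivity⟩, by positivity⟩
  have hlow : ∀ {c d : ℝ}, c ≠ d → ((c + d) / 2, -(|d - c| / 2)) ∈ lowerHalfCircle c d ∧
      -(|d - c| / 2) < 0 := by
    intro c d hcd
    have : 0 < |d - c| := abs_pos.2 (sub_ne_zero.2 hcd.symm)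
    exact ⟨⟨by simp [div_pow], by simp only; linarith⟩, by linarith⟩
  obtain ⟨m, hma, hmb, rfl | rfl⟩ := h
  · exact ⟨⟨_, Or.inl (hup hma.symm).1, (hup hma.symm).2⟩,
      ⟨_, Or.inr (hlow hmb).1, (hlow hmb).2⟩⟩
  · exact ⟨⟨_, Or.inr (hup hmb).1, (hup hmb).2⟩,
      ⟨_, Or.inl (hlow hma.symm).1, (hlow hma.symm).2⟩⟩

theorem not_isBiarc_halfCircle (σ : Bool) (a b c d : ℝ) : ¬ IsBiarc (halfCircle σ a b) c d := by
  intro h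
  obtain ⟨⟨p, hp, hp'⟩, q, hq, hq'⟩ := h.exists_pos_and_neg
  have h1 := (mem_halfCircle.1 hp).2
  have h2 := (mem_halfCircle.1 hq).2
  cases σ <;> simp at h1 h2 <;> linarith

theorem isProperArc_iff_exists_halfCircle {S : Set (ℝ × ℝ)} {a b : ℝ} :
    IsProperArc S a b ↔ ∃ σ, S = halfCircle σ a b := by
  simp [IsProperArc, halfCircle, or_comm]

theorem isBiarc_iff_exists_halfCircle {S : Set (ℝ × ℝ)} {a b : ℝ} :
    IsBiarc S a b ↔
      ∃ m, m ≠ a ∧ m ≠ b ∧ ∃ σ τ, σ ≠ τ ∧ S = halfCircle σ a m ∪ halfCircle τ m b := by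
  simp [IsBiarc, halfCircle, or_comm]

/-! ### Biarc diagrams and book embeddings of subdivisions -/

namespace SimpleGraph

universe u

variable {V : Type u} {G : SimpleGraph V} {F : Finset (Sym2 V)}

/-- The edge `f` of a subdivision is a part of the edge `e` of the original graph. -/
def IsPart (F : Finset (Sym2 V)) (e : Sym2 V) (f : Sym2 (V ⊕ F)) : Prop :=
  (e ∉ F ∧ f = e.map Sum.inl) ∨ ∃ h : e ∈ F, ∃ u ∈ e, f = s(Sum.inl u, Sum.inr ⟨e, h⟩)

namespace IsPart

variable {e e' : Sym2 V} {f f' : Sym2 (V ⊕ F)}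

theorem mem_of_inl_mem (h : IsPart F e f) {u : V} (hu : Sum.inl u ∈ f) : u ∈ e := by
  rcases h with ⟨-, rfl⟩ | ⟨h, v, hv, rfl⟩
  · simpa using hu
  · simp only [Sym2.mem_iff, Sum.inl.injEq, reduceCtorEq, or_false] at hu
    exact hu ▸ hv

theorem eq_of_inr_mem (h : IsPart F e f) {g : F} (hg : Sum.inr g ∈ f) : g.1 = e := by
  rcases h with ⟨-, rfl⟩ | ⟨h, v, hv, rfl⟩
  · simp at hg
  · simp only [Sym2.mem_iff, Sum.inr.injEq, reduceCtorEq, false_or] at hg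
    rw [hg]

theorem mem_edgeSet (h : IsPart F e f) (he : e ∈ G.edgeSet) : f ∈ (G.subdivide F).edgeSet := by
  rcases h with ⟨hF, rfl⟩ | ⟨h, v, hv, rfl⟩
  · induction e using Sym2.ind with
    | _ u v => exact ⟨he, hF⟩
  · exact hv

theorem unique (h : IsPart F e f) (h' : IsPart F e' f) : e = e' := by
  rcases h with ⟨hF, rfl⟩ | ⟨h, v, hv, rfl⟩
  · rcases h' with ⟨hF', hf⟩ | ⟨h', v', hv', hf⟩
    · exact Sym2.map.injective Sum.inl_injective hf
    · have : Sum.inr ⟨e', h'⟩ ∈ e.map (Sum.inl : V → V ⊕ F) := hf ▸ Sym2.mem_mk_right _ _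
      simp at this
  · exact h'.eq_of_inr_mem (Sym2.mem_mk_right _ _)

/-- Consequently, edges with alternating, hence distinct, endpoints are parts of different edges of
the original graph. -/
theorem exists_mem (h : IsPart F e f) (h' : IsPart F e f') : ∃ w, w ∈ f ∧ w ∈ f' := by
  rcases h with ⟨hF, rfl⟩ | ⟨h, v, hv, rfl⟩
  · rcases h' with ⟨hF', rfl⟩ | ⟨h', -⟩
    · induction e using Sym2.ind with
      | _ u v => exact ⟨Sum.inl u, by simp, by simp⟩
    · exact absurd h' hF
  · rcases h' with ⟨hF', -⟩ | ⟨h', v', hv', rfl⟩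
    · exact absurd h hF'
    · exact ⟨Sum.inr ⟨e, h⟩, by simp, by simp⟩

end IsPart

/-- A two-page book embedding of a subdivision in which the two edges at every subdivision vertex
have different colours gives a biarc diagram. -/
theorem IsTwoPage.exists_biarcDiagram {pos : V ⊕ F → ℝ}
    {col : Sym2 (V ⊕ F) → Bool} (h : (G.subdivide F).IsTwoPage pos col)
    (hcol : ∀ (e : F) (u v : V), e.1 = s(u, v) →
      col s(Sum.inl u, Sum.inr e) ≠ col s(Sum.inl v, Sum.inr e)) :
    ∃ D : G.Drawing, D.IsPlane ∧ D.IsBiarcDiagram ∧ D.biarcs ⊆ F := by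
  obtain ⟨D, hD, hpt, harc⟩ := h.exists_drawing
  let A : Sym2 V → Set (ℝ × ℝ) := fun e => {p | ∃ f, IsPart F e f ∧ p ∈ D.arc f}
  have hA : ∀ u v, s(u, v) ∉ F → A s(u, v) = D.arc s(Sum.inl u, Sum.inl v) := by
    intro u v huv
    ext p
    constructor
    · rintro ⟨f, ⟨-, rfl⟩ | ⟨h', -⟩, hp⟩
      · exact hp
      · exact absurd h' huv
    · exact fun hp => ⟨_, Or.inl ⟨huv, rfl⟩, hp⟩
  have hA' : ∀ u v, ∀ he : s(u, v) ∈ F, A s(u, v) =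
      D.arc s(Sum.inl u, Sum.inr ⟨_, he⟩) ∪ D.arc s(Sum.inr ⟨_, he⟩, Sum.inl v) := by
    intro u v he
    ext p
    constructor
    · rintro ⟨f, ⟨h', -⟩ | ⟨h', w, hw, rfl⟩, hp⟩
      · exact absurd he h'
      · rcases Sym2.mem_iff.1 hw with rfl | rfl
        · exact Or.inl hp
        · exact Or.inr (by rwa [Sym2.eq_swap])
    · rintro (hp | hp)
      · exact ⟨_, Or.inr ⟨he, u, by simp, rfl⟩, hp⟩
      · exact ⟨_, Or.inr ⟨he, v, by simp, Sym2.eq_swap⟩, hp⟩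
  refine ⟨⟨fun v => D.point (Sum.inl v), A, D.point_injective.comp Sum.inl_injective, ?_, ?_⟩,
    ?_, ⟨?_, ?_⟩, ?_⟩
  · intro u v huv
    by_cases he : s(u, v) ∈ F
    · rw [hA' u v he]
      have a1 : (G.subdivide F).Adj (Sum.inl u) (Sum.inr ⟨_, he⟩) := Sym2.mem_mk_left u v
      have a2 : (G.subdivide F).Adj (Sum.inr ⟨_, he⟩) (Sum.inl v) := Sym2.mem_mk_right u v
      refine (D.isJordanArc _ _ a1).union (D.isJordanArc _ _ a2) fun p hp => ?_
      obtain ⟨w, hw, hw', rfl⟩ := hD _ a1 _ a2 (by simp [huv.ne]) p hp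
      rcases Sym2.mem_iff.1 hw with rfl | rfl
      · simp [huv.ne] at hw'
      · rfl
    · rw [hA u v he]
      exact D.isJordanArc _ _ ⟨huv, he⟩
  · rintro e he w ⟨f, hf, hw⟩
    exact hf.mem_of_inl_mem (D.mem_of_point_mem_arc f (hf.mem_edgeSet he) _ hw)
  · rintro e he e' he' hne p ⟨⟨f, hf, hp⟩, f', hf', hp'⟩
    obtain ⟨w, hw, hw', rfl⟩ := hD f (hf.mem_edgeSet he) f' (hf'.mem_edgeSet he')
      (fun hff => hne (hf.unique (hff ▸ hf'))) p ⟨hp, hp'⟩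
    -- A common point is a vertex of the subdivision, and a subdivision vertex belongs to parts of
    -- only one edge.
    rcases w with v | g
    · exact ⟨v, hf.mem_of_inl_mem hw, hf'.mem_of_inl_mem hw', rfl⟩
    · exact absurd ((hf.eq_of_inr_mem hw).symm.trans (hf'.eq_of_inr_mem hw')) hne
  · intro v
    simp [hpt]
  · intro u v huv
    simp only [hpt]
    by_cases he : s(u, v) ∈ F
    · right
      rw [hA' u v he, isBiarc_iff_exists_halfCircle]
      refine ⟨pos (Sum.inr ⟨_, he⟩), h.injective.ne (by simp), h.injective.ne (by simp), _, _,
        ?_, by rw [harc, harc]⟩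
      rw [Sym2.eq_swap (b := Sum.inl v)]
      exact hcol ⟨_, he⟩ u v rfl
    · left
      rw [hA u v he, isProperArc_iff_exists_halfCircle]
      exact ⟨_, harc _ _⟩
  · rintro e ⟨u, v, huv, rfl, hb⟩
    by_contra he
    replace hb : IsBiarc (A s(u, v)) (D.point (Sum.inl u)).1 (D.point (Sum.inl v)).1 := hb
    rw [hA u v he, harc] at hb
    exact not_isBiarc_halfCircle _ _ _ _ _ hb

/-- Subdividing the biarcs of a plane biarc diagram yields a two-page book embedding. -/
theorem Drawing.IsBiarcDiagram.exists_isTwoPage {D : G.Drawing} (hD : D.IsBiarcDiagram)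
    (hpl : D.IsPlane) (hF : (F : Set (Sym2 V)) = D.biarcs) :
    ∃ pos col, (G.subdivide F).IsTwoPage pos col := by
  obtain ⟨h0, harc⟩ := hD
  have hFG : (F : Set (Sym2 V)) ⊆ G.edgeSet := by
    rw [hF]
    rintro e ⟨u, v, huv, rfl, -⟩
    exact huv
  have hpt : ∀ v, D.point v = ((D.point v).1, 0) := fun v => Prod.ext rfl (h0 v)
  -- The point where the biarc switches sides becomes the position of the subdivision vertex.
  have hmid : ∀ e : F, ∃ m : ℝ, ∀ u ∈ e.1, m ≠ (D.point u).1 ∧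
      ∃ σ, halfCircle σ (D.point u).1 m ⊆ D.arc e.1 := by
    intro e
    obtain ⟨u, v, huv, he, hb⟩ : e.1 ∈ D.biarcs := hF ▸ e.2
    obtain ⟨m, hmu, hmv, σ, τ, -, hS⟩ := isBiarc_iff_exists_halfCircle.1 hb
    refine ⟨m, fun w hw => ?_⟩
    rw [hS]
    rw [he] at hw
    rcases Sym2.mem_iff.1 hw with rfl | rfl
    · exact ⟨hmu, σ, Set.subset_union_left⟩
    · exact ⟨hmv, τ, by rw [halfCircle_comm]; exact Set.subset_union_right⟩
  choose m hm using hmid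
  have hm_mem : ∀ e : F, (m e, (0 : ℝ)) ∈ D.arc e.1 := by
    intro e
    obtain ⟨u, hu⟩ : ∃ u, u ∈ e.1 := ⟨_, e.1.out_fst_mem⟩
    obtain ⟨-, σ, hσ⟩ := hm e u hu
    exact hσ (right_mem_halfCircle _ _ _)
  let pos : V ⊕ F → ℝ := Sum.elim (fun v => (D.point v).1) m
  have hinr : ∀ (v : V) (e : F), (D.point v).1 ≠ m e := by
    intro v e hve
    -- A vertex at this point would lie on the arc and so be an end of `e`, making a halfcircle
    -- degenerate.
    have hv : v ∈ e.1 := D.mem_of_point_mem_arc _ (hFG e.2) v (by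
      rw [hpt v, hve]
      exact hm_mem e)
    exact (hm e v hv).1 hve.symm
  have hinj : Function.Injective pos := by
    rintro (u | e) (v | f) huv
    · refine congrArg Sum.inl (D.point_injective ?_)
      rw [hpt u, hpt v]
      exact congrArg (fun z => (z, (0 : ℝ))) huv
    · exact absurd huv (hinr u f)
    · exact absurd huv.symm (hinr v e)
    · by_contra hne
      have huv' : m e = m f := huv
      obtain ⟨v, -, -, hv⟩ := hpl _ (hFG e.2) _ (hFG f.2)
        (fun hef => hne (congrArg Sum.inr (Subtype.ext hef))) (m e, 0)
        ⟨hm_mem e, huv' ▸ hm_mem f⟩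
      exact hinr v e (congrArg Prod.fst hv.symm)
  have hhalf : ∀ x y, (G.subdivide F).Adj x y →
      ∃ σ, ∃ e ∈ G.edgeSet, IsPart F e s(x, y) ∧ halfCircle σ (pos x) (pos y) ⊆ D.arc e := by
    rintro (u | e) (v | f) hxy
    · have hp : IsProperArc (D.arc s(u, v)) (D.point u).1 (D.point v).1 := by
        refine (harc u v hxy.1).resolve_right fun hb => hxy.2 ?_
        rw [← Finset.mem_coe, hF]
        exact ⟨u, v, hxy.1, rfl, hb⟩
      obtain ⟨σ, hσ⟩ := isProperArc_iff_exists_halfCircle.1 hp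
      exact ⟨σ, s(u, v), hxy.1, Or.inl ⟨hxy.2, rfl⟩, hσ.ge⟩
    · obtain ⟨-, σ, hσ⟩ := hm f u hxy
      exact ⟨σ, f.1, hFG f.2, Or.inr ⟨f.2, u, hxy, rfl⟩, hσ⟩
    · obtain ⟨-, σ, hσ⟩ := hm e v hxy
      exact ⟨σ, e.1, hFG e.2, Or.inr ⟨e.2, v, hxy, Sym2.eq_swap⟩, by rwa [halfCircle_comm]⟩
    · exact hxy.elim
  have hcol : ∀ f : Sym2 (V ⊕ F), ∃ σ, ∀ x y, f = s(x, y) → (G.subdivide F).Adj x y →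
      ∃ e ∈ G.edgeSet, IsPart F e f ∧ halfCircle σ (pos x) (pos y) ⊆ D.arc e := by
    intro f
    induction f using Sym2.ind with
    | _ x y =>
      by_cases hxy : (G.subdivide F).Adj x y
      · obtain ⟨σ, e, he, hef, hσ⟩ := hhalf x y hxy
        refine ⟨σ, fun x' y' h' _ => ⟨e, he, hef, ?_⟩⟩
        rcases Sym2.eq_iff.1 h' with ⟨rfl, rfl⟩ | ⟨rfl, rfl⟩
        · exact hσ
        · rwa [halfCircle_comm]
      · refine ⟨true, fun x' y' h' hxy' => absurd ?_ hxy⟩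
        rwa [← mem_edgeSet, h']
  choose col hcol using hcol
  refine ⟨pos, col, hinj, ?_⟩
  intro u v x y huv hxy h1 h2 h3 hc
  obtain ⟨e, he, hef, hsub⟩ := hcol _ u v rfl huv
  obtain ⟨e', he', hef', hsub'⟩ := hcol _ x y rfl hxy
  rw [← hc] at hsub'
  have hne : e ≠ e' := by
    rintro rfl
    obtain ⟨w, hw, hw'⟩ := hef.exists_mem hef'
    rcases Sym2.mem_iff.1 hw with rfl | rfl <;> rcases Sym2.mem_iff.1 hw' with rfl | rfl <;>
      linarith
  -- Halfcircles of equal colour would meet off the spine, but arcs of different edges meet only at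
  -- vertices, which are on it.
  obtain ⟨p, hp, hp', hp0⟩ := exists_mem_halfCircle_of_alternating (col s(u, v)) h1 h2 h3
  obtain ⟨w, -, -, rfl⟩ := hpl e he e' he' hne p ⟨hsub hp, hsub' hp'⟩
  exact hp0 (h0 w)

end SimpleGraph

/-! ### The equivalence -/

theorem theorem2 {V : Type*} [Fintype V] [DecidableEq V] (G : SimpleGraph V)
    (hV : 3 ≤ Fintype.card V) (hG : G.IsPlanar) (k : ℕ) :
    (∃ D : G.Drawing, D.IsPlane ∧ D.IsBiarcDiagram ∧ D.biarcs.ncard ≤ k) ↔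
      ∃ F : Finset (Sym2 V), (F : Set (Sym2 V)) ⊆ G.edgeSet ∧ F.card ≤ k ∧
        (G.subdivide F).IsSubhamiltonian := by
  have hcard : ∀ F : Finset (Sym2 V), 3 ≤ Fintype.card (V ⊕ F) := fun F => by
    rw [Fintype.card_sum]
    omega
  constructor
  · rintro ⟨D, hpl, hD, hk⟩
    have hF : ((Set.toFinite D.biarcs).toFinset : Set (Sym2 V)) = D.biarcs :=
      Set.Finite.coe_toFinset _
    obtain ⟨pos, col, h⟩ := hD.exists_isTwoPage hpl hF
    refine ⟨_, ?_, ?_, h.isSubhamiltonian (hcard _)⟩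
    · rw [hF]
      rintro e ⟨u, v, huv, rfl, -⟩
      exact huv
    · rwa [← Set.ncard_coe_finset, hF]
  · rintro ⟨F, -, hk, H, hle, hpl, hH⟩
    obtain ⟨pos, col, h⟩ := hpl.exists_isTwoPage hH (by have := hcard F; omega)
    -- A book embedding restricts to subgraphs, so the augmenting edges can be dropped.
    have h' : (G.subdivide F).IsTwoPage pos col :=
      ⟨h.injective, fun u v x y huv hxy => h.col_ne u v x y (hle huv) (hle hxy)⟩
    obtain ⟨F', hF', pos', col', h₂, hcol⟩ := h'.exists_subset_col_ne
    obtain ⟨D, hD, hbi, hsub⟩ := h₂.exists_biarcDiagram hcol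
    refine ⟨D, hD, hbi, ?_⟩
    calc D.biarcs.ncard ≤ (F' : Set (Sym2 V)).ncard := Set.ncard_le_ncard hsub F'.finite_toSet
      _ = F'.card := Set.ncard_coe_finset _
      _ ≤ F.card := Finset.card_le_card hF'
      _ ≤ k := hk
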